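/- Let $\mathcal A$ be a real central hyperplane arrangement, i.e. a finite set of linear hyperplanes in $\mathbb R^n$. Its chambers are the connected components of $\mathbb R^n\setminus\bigcup_{H\in\mathcal A}H$. For chambers $c,d$ let $S(c,d)$ be the set of hyperplanes in $\mathcal A$ that separate $c$ from $d$. Fix a chamber $c_0$ (the fundamental chamber), and let $\mathcal P(\mathcal A,c_0)$ be the set of chambers, partially ordered by $c\le d$ if and only if $S(c_0,c)\subseteq S(c_0,d)$. A chamber $c$ is said to be incident to an intersection subspace $X$ of $\mathcal A$ if $\overline{c}\cap X$ linearly spans $X$, i.e. $X$ is the linear span of a face of $\overline c$. An upper wall of $c$ is a hyperplane $H\in\mathcal A$ incident to $c$ with $H\notin S(c_0,c)$. The pair $(\mathcal A,c_0)$ is bineighborly if for every chamber $c$ and all upper walls $H,H'$ of $c$, the chamber $c$ is incident to $H\cap H'$. A lattice is crosscut-simplicial if for every interval $[x,y]$ and every proper subset $B$ of the set of atoms of $[x,y]$ (the elements $z\le y$ covering $x$), the join of $B$ is not equal to $y$. A lattice is semidistributive if for all $x,y,z$, $x\wedge z=y\wedge z$ implies $(x\vee y)\wedge z=x\wedge z$,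 and $x\vee z=y\vee z$ implies $(x\wedge y)\vee z=x\vee z$. **Theorem.** The following are equivalent: 1. $\mathcal P(\mathcal A,c_0)$ is a crosscut-simplicial lattice; 2. $\mathcal P(\mathcal A,c_0)$ is a semidistributive lattice; 3. $(\mathcal A,c_0)$ is bineighborly. -/

import Mathlib

section LatticeNotions

/-- A poset is a lattice: every pair of elements has a least upper bound and a greatest
lower bound. -/
def IsLatticePoset (P : Type*) [PartialOrder P] : Prop :=
  ∀ x y : P, (∃ j, IsLUB {x, y} j) ∧ (∃ m, IsGLB {x, y} m)

/-- A lattice with: `x ∧ z = y ∧ z` implies `(x ∨ y) ∧ z = x ∧ z`.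
Here `m` is the common meet and `j` is the join of `x` and `y`. -/
def IsMeetSemidistributiveLattice (P : Type*) [PartialOrder P] : Prop :=
  IsLatticePoset P ∧ ∀ x y z m j : P,
    IsGLB {x, z} m → IsGLB {y, z} m → IsLUB {x, y} j → IsGLB {j, z} m

/-- A lattice with: `x ∨ z = y ∨ z` implies `(x ∧ y) ∨ z = x ∨ z`. -/
def IsJoinSemidistributiveLattice (P : Type*) [PartialOrder P] : Prop :=
  IsLatticePoset P ∧ ∀ x y z j m : P,
    IsLUB {x, z} j → IsLUB {y, z} j → IsGLB {x, y} m → IsLUB {m, z} j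

/-- A semidistributive lattice is both meet- and join-semidistributive. -/
def IsSemidistributiveLattice (P : Type*) [PartialOrder P] : Prop :=
  IsMeetSemidistributiveLattice P ∧ IsJoinSemidistributiveLattice P

/-- The atoms of the interval `[x, y]`: the elements `z ≤ y` covering `x`. -/
def intervalAtoms {P : Type*} [PartialOrder P] (x y : P) : Set P :=
  {z | x ⋖ z ∧ z ≤ y}

/-- A lattice is crosscut-simplicial if, for every interval `[x, y]`, the join of any proper
subset of the atoms of `[x, y]` is not equal to `y`. -/
def IsCrosscutSimplicialLattice (P : Type*) [PartialOrder P] : Prop :=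
  IsLatticePoset P ∧ ∀ x y : P, x ≤ y → ∀ B : Set P, B ⊂ intervalAtoms x y → ¬ IsLUB B y

end LatticeNotions

/-- A real central hyperplane arrangement: a finite set of linear hyperplanes
(subspaces of dimension `n - 1`) in `ℝⁿ`. -/
structure CentralArrangement (n : ℕ) where
  hyperplanes : Set (Submodule ℝ (EuclideanSpace ℝ (Fin n)))
  finite : hyperplanes.Finite
  finrank_add_one : ∀ H ∈ hyperplanes, Module.finrank ℝ H + 1 = n

namespace CentralArrangement

variable {n : ℕ} (A : CentralArrangement n)

/-- The complement of the union of the hyperplanes. -/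
def compl : Set (EuclideanSpace ℝ (Fin n)) :=
  {x | ∀ H ∈ A.hyperplanes, x ∉ H}

/-- A chamber, given by its open cone: a connected component of the complement. The maximal
closed cones of the fan of the arrangement are the closures of these sets. -/
structure Chamber where
  carrier : Set (EuclideanSpace ℝ (Fin n))
  isComponent : ∃ x ∈ A.compl, carrier = connectedComponentIn A.compl x

variable {A}

/-- The hyperplane `H` strictly separates the chambers `c` and `d`. -/
def Separates (H : Submodule ℝ (EuclideanSpace ℝ (Fin n))) (c d : A.Chamber) : Prop :=
  ∃ f : EuclideanSpace ℝ (Fin n) →ₗ[ℝ] ℝ, LinearMap.ker f = H ∧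
    (∀ x ∈ c.carrier, 0 < f x) ∧ (∀ y ∈ d.carrier, f y < 0)

/-- The separation set `S(c, d)`. -/
def separationSet (c d : A.Chamber) : Set (Submodule ℝ (EuclideanSpace ℝ (Fin n))) :=
  {H | H ∈ A.hyperplanes ∧ Separates H c d}

/-- The chamber `c` is incident to the intersection subspace `X`: the part of the closed cone
of `c` lying in `X` is a full-dimensional cone in `X`, i.e. `X` is the linear span of a face
of `c`. -/
def Incident (c : A.Chamber) (X : Submodule ℝ (EuclideanSpace ℝ (Fin n))) : Prop :=
  Submodule.span ℝ (closure c.carrier ∩ (X : Set (EuclideanSpace ℝ (Fin n)))) = X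

/-- The walls of `c`: the hyperplanes of the arrangement incident to `c`. -/
def walls (c : A.Chamber) : Set (Submodule ℝ (EuclideanSpace ℝ (Fin n))) :=
  {H | H ∈ A.hyperplanes ∧ Incident c H}

/-- The upper walls of `c`: the walls of `c` that do not separate `c₀` from `c`. -/
def upperWalls (c₀ c : A.Chamber) : Set (Submodule ℝ (EuclideanSpace ℝ (Fin n))) :=
  {H | H ∈ walls c ∧ H ∉ separationSet c₀ c}

/-- `(A, c₀)` is bineighborly: every chamber is incident to the intersection of any two of its
upper walls. -/
def IsBineighborly (c₀ : A.Chamber) : Prop :=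
  ∀ c : A.Chamber, ∀ H ∈ upperWalls c₀ c, ∀ H' ∈ upperWalls c₀ c, Incident c (H ⊓ H')

theorem Chamber.carrier_injective {c d : A.Chamber} (h : c.carrier = d.carrier) : c = d := by
  cases c; cases d; cases h; rfl

theorem Chamber.subset_compl (c : A.Chamber) : c.carrier ⊆ A.compl := by
  obtain ⟨x, -, h⟩ := c.isComponent
  rw [h]
  exact connectedComponentIn_subset _ _

theorem Chamber.isPreconnected (c : A.Chamber) : IsPreconnected c.carrier := by
  obtain ⟨x, -, h⟩ := c.isComponent
  rw [h]
  exact isPreconnected_connectedComponentIn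

theorem Chamber.nonempty (c : A.Chamber) : c.carrier.Nonempty := by
  obtain ⟨x, hx, h⟩ := c.isComponent
  exact ⟨x, h ▸ mem_connectedComponentIn hx⟩

theorem Chamber.eq_component (c : A.Chamber) {x : EuclideanSpace ℝ (Fin n)}
    (hx : x ∈ c.carrier) : c.carrier = connectedComponentIn A.compl x := by
  obtain ⟨z, -, h⟩ := c.isComponent
  rw [h] at hx ⊢
  exact connectedComponentIn_eq hx

/-- A linear form vanishing exactly on a hyperplane of `A` has constant sign on a chamber. -/
theorem Chamber.sign_const (c : A.Chamber) {f : EuclideanSpace ℝ (Fin n) →ₗ[ℝ] ℝ}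
    (hf : LinearMap.ker f ∈ A.hyperplanes) :
    (∀ x ∈ c.carrier, 0 < f x) ∨ (∀ x ∈ c.carrier, f x < 0) := by
  have hne : ∀ x ∈ c.carrier, f x ≠ 0 := fun x hx h0 =>
    c.subset_compl hx _ hf (LinearMap.mem_ker.2 h0)
  have hcont : Continuous f := f.continuous_of_finiteDimensional
  by_contra! hcon
  obtain ⟨⟨x, hx, hx0⟩, ⟨y, hy, hy0⟩⟩ := hcon
  obtain ⟨z, hz, hz0⟩ := c.isPreconnected.intermediate_value hx hy hcont.continuousOn
    (show (0 : ℝ) ∈ Set.Icc (f x) (f y) from ⟨hx0, hy0⟩)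
  exact hne z hz hz0

/-- A hyperplane is the kernel of a linear form. -/
theorem exists_ker_eq {H : Submodule ℝ (EuclideanSpace ℝ (Fin n))} (hH : H ∈ A.hyperplanes) :
    ∃ f : EuclideanSpace ℝ (Fin n) →ₗ[ℝ] ℝ, LinearMap.ker f = H := by
  have h1 := A.finrank_add_one H hH
  have h2 := Submodule.finrank_quotient_add_finrank H
  rw [finrank_euclideanSpace_fin] at h2
  have h3 : Module.finrank ℝ (EuclideanSpace ℝ (Fin n) ⧸ H) = Module.finrank ℝ ℝ := by
    rw [Module.finrank_self]; omega
  let e := LinearEquiv.ofFinrankEq _ _ h3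
  refine ⟨e.toLinearMap ∘ₗ H.mkQ, ?_⟩
  rw [LinearMap.ker_comp, LinearEquiv.ker]
  simp

/-- A chamber is determined by its separation set from `c₀`. -/
theorem eq_of_separationSet_eq (c₀ c d : A.Chamber)
    (h : separationSet c₀ c = separationSet c₀ d) : c = d := by
  obtain ⟨x, hx⟩ := c.nonempty
  obtain ⟨y, hy⟩ := d.nonempty
  obtain ⟨p, hp⟩ := c₀.nonempty
  -- a form positive on `c₀` takes the same sign at `x` and at `y`
  have key : ∀ f : EuclideanSpace ℝ (Fin n) →ₗ[ℝ] ℝ, LinearMap.ker f ∈ A.hyperplanes →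
      (∀ q ∈ c₀.carrier, 0 < f q) → (0 < f x ∧ 0 < f y) ∨ (f x < 0 ∧ f y < 0) := by
    intro f hf h0
    have sep : ∀ (a b : A.Chamber), separationSet c₀ a = separationSet c₀ b →
        (∀ z ∈ a.carrier, f z < 0) → ∀ z ∈ b.carrier, 0 < f z → False := by
      intro a b hab ha z hz hz0
      have hm : LinearMap.ker f ∈ separationSet c₀ b := hab ▸ ⟨hf, f, rfl, h0, ha⟩
      obtain ⟨-, g, hg, hg0, hgb⟩ := hm
      -- `f p • z - f z • p` lies in the common kernel
      have hk : f p • z - f z • p ∈ LinearMap.ker f := by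
        rw [LinearMap.mem_ker]; simp; ring
      rw [← hg, LinearMap.mem_ker] at hk
      simp only [map_sub, map_smul, smul_eq_mul] at hk
      have := mul_pos (h0 p hp) (neg_pos.2 (hgb z hz))
      have := mul_pos hz0 (hg0 p hp)
      linarith
    rcases c.sign_const hf with h1 | h1 <;> rcases d.sign_const hf with h2 | h2
    · exact Or.inl ⟨h1 x hx, h2 y hy⟩
    · exact (sep d c h.symm h2 x hx (h1 x hx)).elim
    · exact (sep c d h h1 y hy (h2 y hy)).elim
    · exact Or.inr ⟨h1 x hx, h2 y hy⟩
  have hseg : segment ℝ x y ⊆ A.compl := by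
    rintro z ⟨a, b, ha, hb, hab, rfl⟩ H hH hz
    obtain ⟨f, rfl⟩ := exists_ker_eq hH
    have hz' : a * f x + b * f y = 0 := by simpa using hz
    have hsame : (0 < f x ∧ 0 < f y) ∨ (f x < 0 ∧ f y < 0) := by
      rcases c₀.sign_const hH with h0 | h0
      · exact key f hH h0
      · have hk : LinearMap.ker (-f) = LinearMap.ker f := by ext v; simp
        rcases key (-f) (hk ▸ hH) (fun q hq => by simpa using h0 q hq) with h1 | h1
        · exact Or.inr (by simpa using h1)
        · exact Or.inl (by simpa using h1)
    rcases ha.eq_or_lt with rfl | ha'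
    · have hb1 : b = 1 := by linarith
      subst hb1
      rcases hsame with ⟨h1, h2⟩ | ⟨h1, h2⟩ <;> linarith
    · rcases hsame with ⟨h1, h2⟩ | ⟨h1, h2⟩
      · nlinarith [mul_pos ha' h1, mul_nonneg hb h2.le]
      · nlinarith [mul_pos ha' (neg_pos.2 h1), mul_nonneg hb (neg_pos.2 h2).le]
  apply Chamber.carrier_injective
  have hyc : y ∈ connectedComponentIn A.compl x :=
    (convex_segment x y).isPreconnected.subset_connectedComponentIn
      (left_mem_segment ℝ x y) hseg (right_mem_segment ℝ x y)
  rw [c.eq_component hx, d.eq_component hy]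
  exact connectedComponentIn_eq hyc

/-- The underlying set of the poset of chambers `P(A, c₀)` is the set of chambers of `A`. -/
def ChamberPoset (_c₀ : A.Chamber) : Type := A.Chamber

/-- The order of `P(A, c₀)`: `c ≤ d` if and only if `S(c₀, c) ⊆ S(c₀, d)`. -/
instance (c₀ : A.Chamber) : PartialOrder (ChamberPoset c₀) where
  le c d := separationSet c₀ c ⊆ separationSet c₀ d
  le_refl _ := subset_rfl
  le_trans _ _ _ h₁ h₂ := Set.Subset.trans h₁ h₂
  le_antisymm c d h₁ h₂ := eq_of_separationSet_eq c₀ c d (Set.Subset.antisymm h₁ h₂)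

end CentralArrangement

/-! ### Local-to-global criteria and duality in posets. -/

section PosetLemmas

variable {P : Type*} [PartialOrder P]

/-! Both lattice properties can be tested on neighbours. Let `H ≠ H'` be upper walls of `c`. If `c`
is incident to `H ⊓ H'`, crossing that face reaches a chamber `u` that differs from `c` exactly in
the hyperplanes through `H ⊓ H'`. Their forms are nonnegative combinations of the two wall forms
(`exists_baseForm_eq_add`), so a chamber beyond both walls is beyond all of them, and `u` is the
join of the two neighbours of `c`. The same positivity gives a local meet law (`exists_local_join`).
Well-founded induction makes joins and the meet law global, and negation of chambers supplies the
dual statements.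

Meet-semidistributivity keeps the meet of an omitted atom with the join of the other atoms at the
bottom, which gives crosscut-simpliciality. Under the latter, the interval from `c` to the join `y`
of two neighbours has no further atoms. A point of `y` then violates, among the walls of `c`, only
`H` and `H'`, and it can be pushed into the relative interior of a face spanning `H ⊓ H'`
(`incident_inf_of_separationSet`). -/

theorem isLUB_pair_of_le {x y : P} (h : x ≤ y) : IsLUB {x, y} y :=
  ⟨by rintro _ (rfl | rfl); exacts [h, le_rfl], fun _ hu => hu (by simp)⟩

/-- If any two elements above `w` have elements between that admit a join, then any two elements
with a common lower bound have a join. -/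
theorem exists_isLUB_pair_of_local [Finite P]
    (hloc : ∀ w x y : P, w < x → w < y →
      ∃ x' y' u, w < x' ∧ x' ≤ x ∧ w < y' ∧ y' ≤ y ∧ IsLUB {x', y'} u)
    (w : P) : ∀ x y : P, w ≤ x → w ≤ y → ∃ j, IsLUB {x, y} j := by
  induction w using WellFoundedGT.induction with
  | _ w ih =>
  intro x y hx hy
  rcases hx.eq_or_lt with rfl | hx
  · exact ⟨y, isLUB_pair_of_le hy⟩
  rcases hy.eq_or_lt with rfl | hy
  · exact ⟨x, Set.pair_comm x w ▸ isLUB_pair_of_le hx.le⟩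
  obtain ⟨x', y', u, hwx, hxx, hwy, hyy, hu⟩ := hloc w x y hx hy
  have hxu : x' ≤ u := hu.1 (by simp)
  have hyu : y' ≤ u := hu.1 (by simp)
  -- Glue three joins: `x` with `u` over `x'`, `y` with `u` over `y'`, and the two results over `u`.
  -- All three bases are strictly above `w`.
  obtain ⟨a, ha⟩ := ih x' hwx x u hxx hxu
  obtain ⟨b, hb⟩ := ih y' hwy y u hyy hyu
  obtain ⟨j, hj⟩ := ih u (hwx.trans_le hxu) a b (ha.1 (by simp)) (hb.1 (by simp))
  refine ⟨j, ?_, fun v hv => ?_⟩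
  · rintro _ (rfl | rfl)
    · exact (ha.1 (by simp)).trans (hj.1 (by simp))
    · exact (hb.1 (by simp)).trans (hj.1 (by simp))
  · have hxv : x ≤ v := hv (by simp)
    have hyv : y ≤ v := hv (by simp)
    have huv : u ≤ v := hu.2 (by rintro _ (rfl | rfl); exacts [hxx.trans hxv, hyy.trans hyv])
    refine hj.2 ?_
    rintro _ (rfl | rfl)
    · exact ha.2 (by rintro _ (rfl | rfl) <;> assumption)
    · exact hb.2 (by rintro _ (rfl | rfl) <;> assumption)

/-- A finite lattice is meet-semidistributive if the law holds locally. -/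
theorem isMeetSemidistributiveLattice_of_local [Finite P] (hL : IsLatticePoset P)
    (hloc : ∀ w x y : P, w < x → w < y →
      ∃ x' y' u, w < x' ∧ x' ≤ x ∧ w < y' ∧ y' ≤ y ∧ IsLUB {x', y'} u ∧
        ∀ z m k, IsGLB {x', z} m → IsGLB {y', z} m → IsGLB {u, z} k → k ≤ m) :
    IsMeetSemidistributiveLattice P := by
  have key : ∀ z m w : P, m ≤ w → ∀ x y j : P, w ≤ x → w ≤ y → IsGLB {x, z} m → IsGLB {y, z} m →
      IsLUB {x, y} j → IsGLB {j, z} m := by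
    intro z m w
    induction w using WellFoundedGT.induction with
    | _ w ih =>
    intro hmw x y j hx hy hxm hym hj
    rcases hx.eq_or_lt with rfl | hx
    · exact (hj.unique (isLUB_pair_of_le hy)) ▸ hym
    rcases hy.eq_or_lt with rfl | hy
    · rw [Set.pair_comm] at hj
      exact (hj.unique (isLUB_pair_of_le hx.le)) ▸ hxm
    obtain ⟨x', y', u, hwx, hxx, hwy, hyy, hu, hglb⟩ := hloc w x y hx hy
    have hxu : x' ≤ u := hu.1 (by simp)
    have hyu : y' ≤ u := hu.1 (by simp)
    have hmz : m ≤ z := hxm.1 (by simp)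
    have shrink : ∀ t t' : P, m ≤ t' → t' ≤ t → IsGLB {t, z} m → IsGLB {t', z} m := by
      intro t t' h1 h2 h
      refine ⟨by rintro _ (rfl | rfl) <;> assumption, fun v hv => h.2 ?_⟩
      have hv1 : v ≤ t' := hv (by simp)
      have hv2 : v ≤ z := hv (by simp)
      rintro _ (rfl | rfl)
      exacts [hv1.trans h2, hv2]
    have hx'm := shrink x x' (hmw.trans hwx.le) hxx hxm
    have hy'm := shrink y y' (hmw.trans hwy.le) hyy hym
    have hum : IsGLB {u, z} m := by
      obtain ⟨k, hk⟩ := (hL u z).2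
      have h1 : k ≤ m := hglb z m k hx'm hy'm hk
      have h2 : m ≤ k := hk.2 (by
        rintro _ (rfl | rfl)
        exacts [(hmw.trans hwx.le).trans hxu, hmz])
      exact le_antisymm h1 h2 ▸ hk
    obtain ⟨a, ha⟩ := (hL x u).1
    obtain ⟨b, hb⟩ := (hL y u).1
    have ham := ih x' hwx (hmw.trans hwx.le) x u a hxx hxu hxm hum ha
    have hbm := ih y' hwy (hmw.trans hwy.le) y u b hyy hyu hym hum hb
    have hwu := hwx.trans_le hxu
    refine ih u hwu (hmw.trans hwu.le) a b j (ha.1 (by simp)) (hb.1 (by simp)) ham hbm ⟨?_, ?_⟩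
    · have hxj : x ≤ j := hj.1 (by simp)
      have hyj : y ≤ j := hj.1 (by simp)
      have huj : u ≤ j := hu.2 (by rintro _ (rfl | rfl); exacts [hxx.trans hxj, hyy.trans hyj])
      rintro _ (rfl | rfl)
      · exact ha.2 (by rintro _ (rfl | rfl) <;> assumption)
      · exact hb.2 (by rintro _ (rfl | rfl) <;> assumption)
    · intro v hv
      refine hj.2 ?_
      rintro _ (rfl | rfl)
      · exact (ha.1 (by simp)).trans (hv (by simp))
      · exact (hb.1 (by simp)).trans (hv (by simp))
  refine ⟨hL, fun x y z m j hxm hym hj => ?_⟩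
  obtain ⟨w, hw⟩ := (hL x y).2
  refine key z m w (hw.2 ?_) x y j (hw.1 (by simp)) (hw.1 (by simp)) hxm hym hj
  rintro _ (rfl | rfl)
  exacts [hxm.1 (by simp), hym.1 (by simp)]

theorem CovBy.isGLB_pair_of_ne {x a b : P} (ha : x ⋖ a) (hb : x ⋖ b) (hab : a ≠ b)
    (hL : IsLatticePoset P) : IsGLB {a, b} x := by
  obtain ⟨m, hm⟩ := (hL a b).2
  have hma : m ≤ a := hm.1 (by simp)
  have hmb : m ≤ b := hm.1 (by simp)
  have hxm : x ≤ m := hm.2 (by rintro _ (rfl | rfl); exacts [ha.le, hb.le])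
  rcases ha.eq_or_eq hxm hma with rfl | rfl
  · exact hm
  rcases hb.eq_or_eq hxm hmb with rfl | rfl
  · exact hm
  · exact (hab rfl).elim

/-- A finite meet-semidistributive lattice is crosscut-simplicial. -/
theorem IsMeetSemidistributiveLattice.isCrosscutSimplicialLattice [Finite P]
    (h : IsMeetSemidistributiveLattice P) : IsCrosscutSimplicialLattice P := by
  obtain ⟨hL, hS⟩ := h
  refine ⟨hL, fun x y hxy B hB hy => ?_⟩
  obtain ⟨z, hz, hzB⟩ := Set.exists_of_ssubset hB
  -- Inserting `x` gives the empty set of atoms the join `x`, so the induction can start. Adding an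
  -- atom other than `z` preserves the meet `x` with `z` by the meet law.
  have key : ∃ j, IsLUB (insert x B) j ∧ IsGLB {j, z} x := by
    refine Set.Finite.induction_on_subset
      (motive := fun s _ => ∃ j, IsLUB (insert x s) j ∧ IsGLB {j, z} x) B B.toFinite ?_ ?_
    · refine ⟨x, by simp, ?_, fun v hv => hv (by simp)⟩
      rintro _ (rfl | rfl)
      exacts [le_rfl, hz.1.le]
    · rintro b s hb - - ⟨j, hj, hjz⟩
      obtain ⟨k, hk⟩ := (hL j b).1
      refine ⟨k, ⟨?_, fun v hv => hk.2 ?_⟩, hS j b z x k hjz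
        ((hB.1 hb).1.isGLB_pair_of_ne hz.1 (by rintro rfl; exact hzB hb) hL) hk⟩
      · rintro t (rfl | rfl | ht)
        · exact (hj.1 (by simp)).trans (hk.1 (by simp))
        · exact hk.1 (by simp)
        · exact (hj.1 (by simp [ht])).trans (hk.1 (by simp))
      · rintro _ (rfl | rfl)
        · refine hj.2 ?_
          rintro t (rfl | ht)
          exacts [hv (by simp), hv (by simp [ht])]
        · exact hv (by simp)
  obtain ⟨j, hj, hjz⟩ := key
  have hyj : y ≤ j := hy.2 fun t ht => hj.1 (by simp [ht])
  refine hz.1.lt.not_ge (hjz.2 ?_)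
  rintro _ (rfl | rfl)
  exacts [hz.2.trans hyj, le_rfl]

/-- An antitone involution exchanges least upper and greatest lower bounds of pairs. -/
theorem isLUB_pair_iff_isGLB_of_involutive {ν : P → P} (hν : Function.Involutive ν)
    (hle : ∀ x y, ν x ≤ ν y ↔ y ≤ x) (x y j : P) : IsLUB {x, y} j ↔ IsGLB {ν x, ν y} (ν j) := by
  constructor
  · rintro ⟨h1, h2⟩
    refine ⟨?_, fun v hv => ?_⟩
    · rintro _ (rfl | rfl) <;> exact (hle _ _).2 (h1 (by simp))
    · rw [← hν v, hle]
      refine h2 ?_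
      rintro _ (rfl | rfl) <;> (rw [← hle, hν v]; exact hv (by simp))
  · rintro ⟨h1, h2⟩
    refine ⟨?_, fun v hv => ?_⟩
    · rintro _ (rfl | rfl) <;> exact (hle _ _).1 (h1 (by simp))
    · rw [← hle]
      refine h2 ?_
      rintro _ (rfl | rfl) <;> exact (hle _ _).2 (hv (by simp))

theorem IsLatticePoset.of_involutive {ν : P → P} (hν : Function.Involutive ν)
    (hle : ∀ x y, ν x ≤ ν y ↔ y ≤ x) (h : ∀ x y : P, ∃ j, IsLUB {x, y} j) : IsLatticePoset P := by
  refine fun x y => ⟨h x y, ?_⟩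
  obtain ⟨j, hj⟩ := h (ν x) (ν y)
  rw [isLUB_pair_iff_isGLB_of_involutive hν hle, hν, hν] at hj
  exact ⟨_, hj⟩

theorem IsMeetSemidistributiveLattice.isSemidistributiveLattice_of_involutive {ν : P → P}
    (hν : Function.Involutive ν) (hle : ∀ x y, ν x ≤ ν y ↔ y ≤ x)
    (h : IsMeetSemidistributiveLattice P) : IsSemidistributiveLattice P := by
  refine ⟨h, h.1, fun x y z j m hx hy hm => ?_⟩
  have key := isLUB_pair_iff_isGLB_of_involutive hν hle
  rw [key] at hx hy ⊢
  refine h.2 _ _ _ _ _ hx hy ?_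
  rwa [key, hν, hν, hν]

end PosetLemmas

/-! ### Linear forms, walls and faces of a chamber. -/

namespace CentralArrangement

variable {n : ℕ} {A : CentralArrangement n}

theorem exists_form_pos (c : A.Chamber) {H : Submodule ℝ (EuclideanSpace ℝ (Fin n))}
    (hH : H ∈ A.hyperplanes) :
    ∃ f : EuclideanSpace ℝ (Fin n) →ₗ[ℝ] ℝ, LinearMap.ker f = H ∧ ∀ x ∈ c.carrier, 0 < f x := by
  obtain ⟨f, rfl⟩ := exists_ker_eq hH
  rcases c.sign_const hH with h | h
  · exact ⟨f, rfl, h⟩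
  · exact ⟨-f, by ext v; simp, fun x hx => by simpa using h x hx⟩

open Classical in
/-- A linear form with kernel `H` that is positive on the chamber `c₀`. -/
noncomputable def baseForm (c₀ : A.Chamber) (H : Submodule ℝ (EuclideanSpace ℝ (Fin n))) :
    EuclideanSpace ℝ (Fin n) →ₗ[ℝ] ℝ :=
  if hH : H ∈ A.hyperplanes then (exists_form_pos c₀ hH).choose else 0

theorem ker_baseForm (c₀ : A.Chamber) {H : Submodule ℝ (EuclideanSpace ℝ (Fin n))}
    (hH : H ∈ A.hyperplanes) : LinearMap.ker (baseForm c₀ H) = H := by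
  rw [baseForm, dif_pos hH]
  exact (exists_form_pos c₀ hH).choose_spec.1

theorem baseForm_pos (c₀ : A.Chamber) {H : Submodule ℝ (EuclideanSpace ℝ (Fin n))}
    (hH : H ∈ A.hyperplanes) {x : EuclideanSpace ℝ (Fin n)} (hx : x ∈ c₀.carrier) :
    0 < baseForm c₀ H x := by
  rw [baseForm, dif_pos hH]
  exact (exists_form_pos c₀ hH).choose_spec.2 x hx

theorem baseForm_eq_zero_iff (c₀ : A.Chamber) {H : Submodule ℝ (EuclideanSpace ℝ (Fin n))}
    (hH : H ∈ A.hyperplanes) {x : EuclideanSpace ℝ (Fin n)} : baseForm c₀ H x = 0 ↔ x ∈ H := by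
  rw [← LinearMap.mem_ker, ker_baseForm c₀ hH]

theorem mem_separationSet_iff (c₀ : A.Chamber) {c : A.Chamber}
    {H : Submodule ℝ (EuclideanSpace ℝ (Fin n))} (hH : H ∈ A.hyperplanes)
    {x : EuclideanSpace ℝ (Fin n)} (hx : x ∈ c.carrier) :
    H ∈ separationSet c₀ c ↔ baseForm c₀ H x < 0 := by
  constructor
  · rintro ⟨-, g, hg, hg0, hgc⟩
    obtain ⟨p, hp⟩ := c₀.nonempty
    -- This vector lies in `H`, so `g` kills it too, and the signs of `g` at `p` and `x` decide the
    -- sign of the base form at `x`.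
    have hk : baseForm c₀ H p • x - baseForm c₀ H x • p ∈ H := by
      rw [← baseForm_eq_zero_iff c₀ hH]; simp; ring
    replace hk := LinearMap.mem_ker.1 (hg.ge hk)
    simp only [map_sub, map_smul, smul_eq_mul] at hk
    have h1 := mul_pos (baseForm_pos c₀ hH hp) (neg_pos.2 (hgc x hx))
    by_contra! hcon
    have h2 := mul_nonneg hcon (hg0 p hp).le
    linarith
  · intro h
    refine ⟨hH, _, ker_baseForm c₀ hH, fun _ => baseForm_pos c₀ hH, ?_⟩
    rcases c.sign_const ((ker_baseForm c₀ hH).symm ▸ hH) with h1 | h1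
    · exact absurd (h1 x hx) h.not_gt
    · exact h1

theorem separationSet_subset (c d : A.Chamber) : separationSet c d ⊆ A.hyperplanes :=
  fun _ h => h.1

instance (c₀ : A.Chamber) : Finite (ChamberPoset c₀) := by
  have : Finite {s // s ⊆ A.hyperplanes} := A.finite.finite_subsets
  refine Finite.of_injective (β := {s // s ⊆ A.hyperplanes})
    (fun c : A.Chamber => ⟨separationSet c₀ c, separationSet_subset c₀ c⟩) fun c d h => ?_
  exact eq_of_separationSet_eq c₀ c d (congrArg Subtype.val h)

open Classical in
/-- The form with kernel `H`, proportional to `baseForm c₀ H`, that is positive on `c`. -/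
noncomputable def orientedForm (c₀ c : A.Chamber) (H : Submodule ℝ (EuclideanSpace ℝ (Fin n))) :
    EuclideanSpace ℝ (Fin n) →ₗ[ℝ] ℝ :=
  if H ∈ separationSet c₀ c then -baseForm c₀ H else baseForm c₀ H

section

variable {c₀ c : A.Chamber} {H : Submodule ℝ (EuclideanSpace ℝ (Fin n))}

theorem orientedForm_of_mem (h : H ∈ separationSet c₀ c) :
    orientedForm c₀ c H = -baseForm c₀ H := if_pos h

theorem orientedForm_of_notMem (h : H ∉ separationSet c₀ c) :
    orientedForm c₀ c H = baseForm c₀ H := if_neg h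

theorem orientedForm_eq_zero_iff (hH : H ∈ A.hyperplanes) {x : EuclideanSpace ℝ (Fin n)} :
    orientedForm c₀ c H x = 0 ↔ x ∈ H := by
  rw [← baseForm_eq_zero_iff c₀ hH, orientedForm]
  split_ifs <;> simp

theorem exists_mem_chamber {x : EuclideanSpace ℝ (Fin n)} (hx : x ∈ A.compl) :
    ∃ d : A.Chamber, x ∈ d.carrier :=
  ⟨⟨connectedComponentIn A.compl x, x, hx, rfl⟩, mem_connectedComponentIn hx⟩

theorem orientedForm_pos (hH : H ∈ A.hyperplanes) {x : EuclideanSpace ℝ (Fin n)}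
    (hx : x ∈ c.carrier) : 0 < orientedForm c₀ c H x := by
  have h0 : baseForm c₀ H x ≠ 0 := fun h =>
    c.subset_compl hx H hH ((baseForm_eq_zero_iff c₀ hH).1 h)
  have h := mem_separationSet_iff c₀ hH hx
  by_cases hs : H ∈ separationSet c₀ c
  · rw [orientedForm_of_mem hs]
    simpa using h.1 hs
  · rw [orientedForm_of_notMem hs]
    exact lt_of_le_of_ne (not_lt.1 fun hlt => hs (h.2 hlt)) h0.symm

theorem mem_carrier_of_orientedForm_pos {x : EuclideanSpace ℝ (Fin n)}
    (h : ∀ H ∈ A.hyperplanes, 0 < orientedForm c₀ c H x) : x ∈ c.carrier := by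
  have hx : x ∈ A.compl := fun H hH hxH =>
    (h H hH).ne' ((orientedForm_eq_zero_iff hH).2 hxH)
  obtain ⟨d, hd⟩ := exists_mem_chamber hx
  suffices d = c from this ▸ hd
  refine eq_of_separationSet_eq c₀ d c (Set.ext fun H => ?_)
  by_cases hH : H ∈ A.hyperplanes
  · rw [mem_separationSet_iff c₀ hH hd]
    have := h H hH
    by_cases hs : H ∈ separationSet c₀ c
    · rw [orientedForm_of_mem hs] at this
      simpa [hs] using this
    · rw [orientedForm_of_notMem hs] at this
      simp [hs, this.le]
  · exact ⟨fun h' => (hH h'.1).elim, fun h' => (hH h'.1).elim⟩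

theorem orientedForm_nonneg (hH : H ∈ A.hyperplanes) {x : EuclideanSpace ℝ (Fin n)}
    (hx : x ∈ closure c.carrier) : 0 ≤ orientedForm c₀ c H x := by
  have hcl : IsClosed {x | 0 ≤ orientedForm c₀ c H x} :=
    isClosed_le continuous_const (LinearMap.continuous_of_finiteDimensional _)
  exact closure_minimal (fun y hy => (orientedForm_pos hH hy).le) hcl hx

variable (c₀ c) in
/-- The hyperplanes in `W` suffice to cut out the chamber `c`. -/
def Determines (W : Set (Submodule ℝ (EuclideanSpace ℝ (Fin n)))) : Prop :=
  W ⊆ A.hyperplanes ∧ ∀ x, (∀ H ∈ W, 0 < orientedForm c₀ c H x) → x ∈ c.carrier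

/-- Adding a small positive multiple of a point of `c` makes all the weak inequalities strict. -/
theorem Determines.mem_closure {W : Set (Submodule ℝ (EuclideanSpace ℝ (Fin n)))}
    (hW : Determines c₀ c W) {x : EuclideanSpace ℝ (Fin n)}
    (h : ∀ H ∈ W, 0 ≤ orientedForm c₀ c H x) : x ∈ closure c.carrier := by
  obtain ⟨p, hp⟩ := c.nonempty
  have ht : Filter.Tendsto (fun ε : ℝ => x + ε • p) (nhdsWithin 0 (Set.Ioi 0)) (nhds x) := by
    have : Continuous fun ε : ℝ => x + ε • p := by fun_prop
    simpa using this.continuousWithinAt (x := 0) (s := Set.Ioi 0) |>.tendsto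
  refine mem_closure_of_tendsto ht ?_
  filter_upwards [self_mem_nhdsWithin] with ε hε
  refine hW.2 _ fun H hH => ?_
  have h1 := mul_pos (show (0 : ℝ) < ε from hε) (orientedForm_pos (c₀ := c₀) (hW.1 hH) hp)
  simpa using add_pos_of_nonneg_of_pos (h H hH) h1

/-- For `v` in `X` and small `δ > 0`, finitely many strict inequalities survive the move from `r` to
`r + δ • v`. Both points lie in the closed cone and in `X`, and their difference recovers `v`. -/
theorem Determines.incident {W : Set (Submodule ℝ (EuclideanSpace ℝ (Fin n)))}
    (hW : Determines c₀ c W) {X : Submodule ℝ (EuclideanSpace ℝ (Fin n))}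
    {r : EuclideanSpace ℝ (Fin n)} (hr : r ∈ X)
    (h : ∀ K ∈ W, X ≤ K ∨ 0 < orientedForm c₀ c K r) : Incident c X := by
  refine le_antisymm (Submodule.span_le.2 Set.inter_subset_right) fun v hv => ?_
  have hfin : W.Finite := A.finite.subset hW.1
  have hev : ∀ᶠ δ : ℝ in nhdsWithin 0 (Set.Ioi 0),
      ∀ K ∈ W, 0 ≤ orientedForm c₀ c K (r + δ • v) := by
    rw [Filter.eventually_all_finite hfin]
    intro K hK
    rcases h K hK with hXK | hpos
    · refine Filter.Eventually.of_forall fun δ => ?_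
      exact ((orientedForm_eq_zero_iff (hW.1 hK)).2
        (hXK (X.add_mem hr (X.smul_mem _ hv)))).ge
    · have hc : Continuous fun δ : ℝ => orientedForm c₀ c K (r + δ • v) :=
        (LinearMap.continuous_of_finiteDimensional _).comp (by fun_prop)
      have h0 : 0 < (fun δ : ℝ => orientedForm c₀ c K (r + δ • v)) 0 := by simpa using hpos
      exact ((hc.continuousAt.eventually_const_lt h0).filter_mono nhdsWithin_le_nhds).mono
        fun _ => le_of_lt
  obtain ⟨δ, hδ, hδ0⟩ := (hev.and self_mem_nhdsWithin).exists
  have hδ0 : (0 : ℝ) < δ := hδ0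
  have hrc : r ∈ closure c.carrier := hW.mem_closure fun K hK =>
    (h K hK).elim (fun hX => ((orientedForm_eq_zero_iff (hW.1 hK)).2 (hX hr)).ge) le_of_lt
  have h1 : r ∈ Submodule.span ℝ (closure c.carrier ∩ X) := Submodule.subset_span ⟨hrc, hr⟩
  have h2 : r + δ • v ∈ Submodule.span ℝ (closure c.carrier ∩ X) :=
    Submodule.subset_span ⟨hW.mem_closure hδ, X.add_mem hr (X.smul_mem _ hv)⟩
  have h3 := Submodule.smul_mem _ δ⁻¹ (Submodule.sub_mem _ h2 h1)
  rwa [add_sub_cancel_left, inv_smul_smul₀ hδ0.ne'] at h3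

variable (c₀ c) in
theorem determines_hyperplanes : Determines c₀ c A.hyperplanes :=
  ⟨subset_rfl, fun _ => mem_carrier_of_orientedForm_pos⟩

variable (c₀ c) in
/-- A chamber is cut out by its walls. -/
theorem determines_walls : Determines c₀ c (walls c) := by
  have hfin : {W | Determines c₀ c W}.Finite :=
    A.finite.finite_subsets.subset fun W hW => hW.1
  -- Every member of a minimal determining set is a wall: dropping `H` admits a point `q` outside
  -- `c`, which can violate only the inequality of `H`.
  obtain ⟨W, hW⟩ := hfin.exists_minimal ⟨_, determines_hyperplanes c₀ c⟩
  have hWdet : Determines c₀ c W := hW.prop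
  refine ⟨fun H hH => hH.1, fun x hx => hWdet.2 x fun H hH => hx H ⟨hWdet.1 hH, ?_⟩⟩
  have hnot : ¬ Determines c₀ c (W \ {H}) := fun hd =>
    (hW.le_of_le hd Set.sdiff_subset hH).2 rfl
  obtain ⟨q, hq, hqc⟩ : ∃ q, (∀ K ∈ W \ {H}, 0 < orientedForm c₀ c K q) ∧ q ∉ c.carrier := by
    by_contra! hcon
    exact hnot ⟨Set.sdiff_subset.trans hWdet.1, hcon⟩
  have hqH : orientedForm c₀ c H q ≤ 0 := by
    by_contra! hcon
    refine hqc (hWdet.2 q fun K hK => ?_)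
    by_cases hKH : K = H
    · exact hKH ▸ hcon
    · exact hq K ⟨hK, hKH⟩
  obtain ⟨p, hp⟩ := c.nonempty
  have hpH := orientedForm_pos (c₀ := c₀) (hWdet.1 hH) hp
  -- Up to a positive scalar, `r` is the point where the segment from `p` to `q` meets `H`.
  refine hWdet.incident (r := orientedForm c₀ c H p • q - orientedForm c₀ c H q • p) ?_ ?_
  · rw [← orientedForm_eq_zero_iff (c₀ := c₀) (c := c) (hWdet.1 hH)]
    simp; ring
  · intro K hK
    by_cases hKH : K = H
    · exact Or.inl hKH.ge
    · right
      have h1 := mul_pos hpH (hq K ⟨hK, hKH⟩)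
      have h2 := mul_nonneg (neg_nonneg.2 hqH) (orientedForm_pos (c₀ := c₀) (hWdet.1 hK) hp).le
      simp only [map_sub, map_smul, smul_eq_mul]
      linarith

variable (c₀) in
/-- A relative interior point of the face of `c` spanning `X`. -/
theorem Incident.exists_point {X : Submodule ℝ (EuclideanSpace ℝ (Fin n))} (hX : Incident c X) :
    ∃ r ∈ X, ∀ K ∈ A.hyperplanes, ¬ X ≤ K → 0 < orientedForm c₀ c K r := by
  have hpt : ∀ K : Submodule ℝ (EuclideanSpace ℝ (Fin n)), ∃ r ∈ closure c.carrier ∩ X,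
      K ∈ A.hyperplanes → ¬ X ≤ K → 0 < orientedForm c₀ c K r := by
    intro K
    by_cases hK : K ∈ A.hyperplanes ∧ ¬ X ≤ K
    · by_contra! hcon
      refine hK.2 (hX ▸ Submodule.span_le.2 fun r hr => ?_)
      exact (orientedForm_eq_zero_iff hK.1).1
        (le_antisymm (hcon r hr).2.2 (orientedForm_nonneg hK.1 hr.1))
    · refine ⟨0, ⟨(determines_hyperplanes c₀ c).mem_closure (by simp), X.zero_mem⟩, fun h1 h2 => ?_⟩
      exact (hK ⟨h1, h2⟩).elim
  choose r hr hpos using hpt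
  -- Each summand is nonnegative for every form, and the summand indexed by `K` is positive for the
  -- form of `K`.
  refine ⟨∑ K ∈ A.finite.toFinset, r K, X.sum_mem fun K _ => (hr K).2, fun K hK hXK => ?_⟩
  rw [map_sum]
  exact Finset.sum_pos' (fun J _ => orientedForm_nonneg hK (hr J).1)
    ⟨K, by simpa using hK, hpos K hK hXK⟩

/-- Crossing from `c` through the face spanning `X`, when no hyperplane through `X` separates
`c₀` from `c`. -/
theorem Incident.exists_separationSet_eq {X : Submodule ℝ (EuclideanSpace ℝ (Fin n))}
    (hX : Incident c X) (hsep : ∀ K ∈ A.hyperplanes, X ≤ K → K ∉ separationSet c₀ c) :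
    ∃ d : A.Chamber, separationSet c₀ d = separationSet c₀ c ∪ {K | K ∈ A.hyperplanes ∧ X ≤ K} := by
  obtain ⟨r, hr, hpos⟩ := hX.exists_point c₀
  obtain ⟨p, hp⟩ := c.nonempty
  -- Moving from `r` away from `p` changes the sign of exactly the forms that vanish on `X`.
  have hev : ∀ᶠ δ : ℝ in nhdsWithin 0 (Set.Ioi 0),
      ∀ K ∈ A.hyperplanes, ¬ X ≤ K → 0 < orientedForm c₀ c K (r - δ • p) := by
    rw [Filter.eventually_all_finite A.finite]
    intro K hK
    by_cases hXK : X ≤ K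
    · exact Filter.Eventually.of_forall fun δ h => (h hXK).elim
    · have hc : Continuous fun δ : ℝ => orientedForm c₀ c K (r - δ • p) :=
        (LinearMap.continuous_of_finiteDimensional _).comp (by fun_prop)
      have h0 : 0 < (fun δ : ℝ => orientedForm c₀ c K (r - δ • p)) 0 := by
        simpa using hpos K hK hXK
      exact ((hc.continuousAt.eventually_const_lt h0).filter_mono nhdsWithin_le_nhds).mono
        fun _ h _ => h
  obtain ⟨δ, hδ, hδ0⟩ := (hev.and self_mem_nhdsWithin).exists
  have hδ0 : (0 : ℝ) < δ := hδ0
  have hneg : ∀ K ∈ A.hyperplanes, X ≤ K → orientedForm c₀ c K (r - δ • p) < 0 := by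
    intro K hK hXK
    have h0 : orientedForm c₀ c K r = 0 := (orientedForm_eq_zero_iff hK).2 (hXK hr)
    have := mul_pos hδ0 (orientedForm_pos (c₀ := c₀) hK hp)
    simpa [h0] using this
  have hcompl : r - δ • p ∈ A.compl := by
    intro K hK hmem
    have h0 := (orientedForm_eq_zero_iff (c₀ := c₀) (c := c) hK).2 hmem
    by_cases hXK : X ≤ K
    · exact (hneg K hK hXK).ne h0
    · exact (hδ K hK hXK).ne' h0
  obtain ⟨d, hd⟩ := exists_mem_chamber hcompl
  refine ⟨d, Set.ext fun K => ?_⟩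
  by_cases hK : K ∈ A.hyperplanes
  swap
  · refine ⟨fun h => (hK h.1).elim, ?_⟩
    rintro (h | h) <;> exact (hK h.1).elim
  rw [mem_separationSet_iff c₀ hK hd]
  by_cases hXK : X ≤ K
  · have h1 := hneg K hK hXK
    rw [orientedForm_of_notMem (hsep K hK hXK)] at h1
    exact ⟨fun _ => Or.inr ⟨hK, hXK⟩, fun _ => h1⟩
  · have h1 := hδ K hK hXK
    by_cases hs : K ∈ separationSet c₀ c
    · rw [orientedForm_of_mem hs, LinearMap.neg_apply, neg_pos] at h1
      exact ⟨fun _ => Or.inl hs, fun _ => h1⟩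
    · rw [orientedForm_of_notMem hs] at h1
      refine ⟨fun h => absurd h h1.not_gt, ?_⟩
      rintro (h | h)
      exacts [(hs h).elim, (hXK h.2).elim]

theorem eq_of_mem_hyperplanes_of_le {K : Submodule ℝ (EuclideanSpace ℝ (Fin n))}
    (hH : H ∈ A.hyperplanes) (hK : K ∈ A.hyperplanes) (h : H ≤ K) : K = H := by
  have h1 := A.finrank_add_one H hH
  have h2 := A.finrank_add_one K hK
  exact (Submodule.eq_of_le_of_finrank_eq h (by omega)).symm

/-- The chamber adjacent to `c` through an upper wall. -/
theorem exists_separationSet_eq_insert (hH : H ∈ upperWalls c₀ c) :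
    ∃ d : A.Chamber, separationSet c₀ d = insert H (separationSet c₀ c) := by
  have hHA := hH.1.1
  obtain ⟨d, hd⟩ := hH.1.2.exists_separationSet_eq (c₀ := c₀) fun K hK hHK =>
    (eq_of_mem_hyperplanes_of_le hHA hK hHK).symm ▸ hH.2
  refine ⟨d, hd.trans (Set.ext fun K => ?_)⟩
  simp only [Set.mem_union, Set.mem_ofPred_eq, Set.mem_insert_iff]
  constructor
  · rintro (h | ⟨h1, h2⟩)
    exacts [Or.inr h, Or.inl (eq_of_mem_hyperplanes_of_le hHA h1 h2)]
  · rintro (rfl | h)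
    exacts [Or.inr ⟨hHA, le_rfl⟩, Or.inl h]

/-- Otherwise a point of `d` satisfies all wall inequalities of `c`, and the walls cut out `c`. -/
theorem exists_upperWall_of_ssubset {d : A.Chamber}
    (h : separationSet c₀ c ⊂ separationSet c₀ d) :
    ∃ H ∈ upperWalls c₀ c, H ∈ separationSet c₀ d := by
  by_contra! hcon
  obtain ⟨q, hq⟩ := d.nonempty
  have hqc : q ∈ c.carrier := (determines_walls c₀ c).2 q fun H hH => by
    have hpos := orientedForm_pos (c₀ := c₀) hH.1 hq
    by_cases hs : H ∈ separationSet c₀ c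
    · rwa [orientedForm_of_mem hs, ← orientedForm_of_mem (h.1 hs)]
    · rwa [orientedForm_of_notMem hs, ← orientedForm_of_notMem (hcon H ⟨hH, hs⟩)]
  have hdc : d = c := Chamber.carrier_injective ((d.eq_component hq).trans (c.eq_component hqc).symm)
  exact h.ne (by rw [hdc])

/-- A point of a wall of `c` lying strictly on the side of `c` of every other hyperplane. -/
theorem exists_point_of_mem_walls (hH : H ∈ walls c) (c₀ : A.Chamber) :
    ∃ r ∈ H, ∀ K ∈ A.hyperplanes, K ≠ H → 0 < orientedForm c₀ c K r := by
  obtain ⟨r, hr, hpos⟩ := hH.2.exists_point c₀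
  exact ⟨r, hr, fun K hK hne => hpos K hK fun h => hne (eq_of_mem_hyperplanes_of_le hH.1 hK h)⟩

/-- A hyperplane through the intersection of two upper walls is given by a nonnegative combination
of the forms of these walls. -/
theorem exists_baseForm_eq_add {H' K : Submodule ℝ (EuclideanSpace ℝ (Fin n))}
    (hH : H ∈ upperWalls c₀ c) (hH' : H' ∈ upperWalls c₀ c) (hne : H ≠ H')
    (hK : K ∈ A.hyperplanes) (hle : H ⊓ H' ≤ K) :
    K ∉ separationSet c₀ c ∧ ∃ a b : ℝ, 0 ≤ a ∧ 0 ≤ b ∧ (0 < a ∨ 0 < b) ∧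
      baseForm c₀ K = a • baseForm c₀ H + b • baseForm c₀ H' := by
  have hker : ⨅ i, LinearMap.ker (![baseForm c₀ H, baseForm c₀ H'] i) ≤
      LinearMap.ker (orientedForm c₀ c K) := by
    intro v hv
    rw [Submodule.mem_iInf] at hv
    have h0 := hv 0
    have h1 := hv 1
    simp only [Matrix.cons_val_zero, Matrix.cons_val_one, ker_baseForm c₀ hH.1.1,
      ker_baseForm c₀ hH'.1.1] at h0 h1
    exact (orientedForm_eq_zero_iff hK).2 (hle ⟨h0, h1⟩)
  have hspan := mem_span_of_iInf_ker_le_ker hker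
  rw [Matrix.range_cons, Matrix.range_cons, Matrix.range_empty, Set.union_empty,
    Set.singleton_union, Submodule.mem_span_pair] at hspan
  obtain ⟨a, b, hab⟩ := hspan
  have happ : ∀ v, orientedForm c₀ c K v = a * baseForm c₀ H v + b * baseForm c₀ H' v :=
    fun v => by rw [← hab]; simp
  -- At a point of the wall `J` off all other hyperplanes, the first term vanishes, which isolates
  -- the sign of `t`.
  have half : ∀ {J J' : Submodule ℝ (EuclideanSpace ℝ (Fin n))} {s t : ℝ},
      J ∈ upperWalls c₀ c → J' ∈ upperWalls c₀ c → J' ≠ J →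
      (∀ v, orientedForm c₀ c K v = s * baseForm c₀ J v + t * baseForm c₀ J' v) → 0 ≤ t := by
    intro J J' s t hJ hJ' hJJ h
    obtain ⟨r, hr, hpos⟩ := exists_point_of_mem_walls hJ.1 c₀
    have h1 := hpos J' hJ'.1.1 hJJ
    rw [orientedForm_of_notMem hJ'.2] at h1
    have h2 : 0 ≤ orientedForm c₀ c K r := by
      by_cases hKJ : K = J
      · exact ((orientedForm_eq_zero_iff hK).2 (hKJ ▸ hr)).ge
      · exact (hpos K hK hKJ).le
    rw [h r, (baseForm_eq_zero_iff c₀ hJ.1.1).2 hr, mul_zero, zero_add] at h2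
    exact nonneg_of_mul_nonneg_left h2 h1
  have hb : 0 ≤ b := half hH hH' hne.symm happ
  have ha : 0 ≤ a := half (s := b) hH' hH hne fun v => by rw [happ]; ring
  have hpos : 0 < a ∨ 0 < b := by
    by_contra! hcon
    obtain ⟨p, hp⟩ := c.nonempty
    have := orientedForm_pos (c₀ := c₀) hK hp
    rw [happ, le_antisymm hcon.1 ha, le_antisymm hcon.2 hb] at this
    simp at this
  -- On `c₀` all base forms are positive, so a nonnegative combination cannot equal the negative of
  -- one.
  have hKs : K ∉ separationSet c₀ c := by
    intro hs
    obtain ⟨p, hp⟩ := c₀.nonempty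
    have h1 := happ p
    rw [orientedForm_of_mem hs, LinearMap.neg_apply] at h1
    have h2 := baseForm_pos c₀ hK hp
    have h3 := mul_nonneg ha (baseForm_pos c₀ hH.1.1 hp).le
    have h4 := mul_nonneg hb (baseForm_pos c₀ hH'.1.1 hp).le
    linarith
  exact ⟨hKs, a, b, ha, hb, hpos, by rw [hab, orientedForm_of_notMem hKs]⟩

end

end CentralArrangement

/-! ### Adjacency, duality and local joins in the poset of chambers. -/

namespace CentralArrangement

variable {n : ℕ} {A : CentralArrangement n}

namespace ChamberPoset

variable {c₀ : A.Chamber}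

theorem le_iff {x y : ChamberPoset c₀} : x ≤ y ↔ separationSet c₀ x ⊆ separationSet c₀ y := Iff.rfl

theorem separationSet_ssubset {x y : ChamberPoset c₀} (h : x < y) :
    separationSet c₀ x ⊂ separationSet c₀ y := h

/-- Above `w` and below `x > w` there is a chamber adjacent to `w`. -/
theorem exists_adjacent_le {w x : ChamberPoset c₀} (h : w < x) :
    ∃ H ∈ upperWalls c₀ w, H ∈ separationSet c₀ x ∧
      ∃ x' : ChamberPoset c₀, separationSet c₀ x' = insert H (separationSet c₀ w) ∧
        w < x' ∧ x' ≤ x := by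
  obtain ⟨H, hH, hHx⟩ := exists_upperWall_of_ssubset (separationSet_ssubset h)
  obtain ⟨x', hx'⟩ := exists_separationSet_eq_insert hH
  change ChamberPoset c₀ at x'
  refine ⟨H, hH, hHx, x', hx', ?_, ?_⟩
  · change separationSet c₀ w ⊂ separationSet c₀ x'
    rw [hx']
    exact Set.ssubset_insert hH.2
  · rw [le_iff, hx']
    exact Set.insert_subset hHx h.le

theorem exists_compl (x : ChamberPoset c₀) :
    ∃ y : ChamberPoset c₀, separationSet c₀ y = A.hyperplanes \ separationSet c₀ x := by
  obtain ⟨p, hp⟩ := Chamber.nonempty x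
  have hmem : -p ∈ A.compl := fun H hH h =>
    Chamber.subset_compl x hp H hH (by simpa using h)
  obtain ⟨d, hd⟩ := exists_mem_chamber hmem
  refine ⟨d, Set.ext fun H => ?_⟩
  by_cases hH : H ∈ A.hyperplanes
  swap
  · exact ⟨fun h => (hH h.1).elim, fun h => (hH h.1).elim⟩
  have h0 : baseForm c₀ H p ≠ 0 := fun h =>
    Chamber.subset_compl x hp H hH ((baseForm_eq_zero_iff c₀ hH).1 h)
  rw [Set.mem_sdiff, mem_separationSet_iff c₀ hH hd, mem_separationSet_iff c₀ hH hp, map_neg,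
    neg_neg_iff_pos, not_lt]
  exact ⟨fun h => ⟨hH, h.le⟩, fun h => lt_of_le_of_ne h.2 h0.symm⟩

variable (c₀) in
/-- Negation of chambers is an antitone involution. -/
theorem exists_antitone_involution : ∃ ν : ChamberPoset c₀ → ChamberPoset c₀,
    Function.Involutive ν ∧ ∀ x y, ν x ≤ ν y ↔ y ≤ x := by
  choose ν hν using exists_compl (c₀ := c₀)
  refine ⟨ν, fun x => eq_of_separationSet_eq c₀ _ _ ?_, fun x y => ?_⟩
  · rw [hν, hν, Set.sdiff_sdiff_cancel_left (separationSet_subset c₀ x)]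
  · rw [le_iff, le_iff, hν, hν]
    exact Set.sdiff_subset_sdiff_iff_subset (separationSet_subset c₀ x) (separationSet_subset c₀ y)

/-- The join of two adjacent chambers above `w`, together with the local form of meet
semidistributivity. -/
theorem exists_local_join (h : IsBineighborly c₀) (w x y : ChamberPoset c₀) (hx : w < x)
    (hy : w < y) : ∃ x' y' u, w < x' ∧ x' ≤ x ∧ w < y' ∧ y' ≤ y ∧ IsLUB {x', y'} u ∧
      ∀ z m k, IsGLB {x', z} m → IsGLB {y', z} m → IsGLB {u, z} k → k ≤ m := by
  obtain ⟨H, hH, -, x', hx', hwx, hxx⟩ := exists_adjacent_le hx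
  obtain ⟨H', hH', -, y', hy', hwy, hyy⟩ := exists_adjacent_le hy
  by_cases hne : H = H'
  · have hxy : x' = y' := eq_of_separationSet_eq c₀ _ _ (by rw [hx', hy', hne])
    subst hxy
    exact ⟨x', x', x', hwx, hxx, hwx, hyy, isLUB_pair_of_le le_rfl,
      fun z m k hm _ hk => (hm.unique hk).ge⟩
  have hcone := fun {K} hK hle => exists_baseForm_eq_add (K := K) hH hH' hne hK hle
  obtain ⟨u, hu⟩ := (h w H hH H' hH').exists_separationSet_eq fun K hK hle => (hcone hK hle).1
  change ChamberPoset c₀ at u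
  have hxu : x' ≤ u := by
    rw [le_iff, hx', hu]
    exact Set.insert_subset (Or.inr ⟨hH.1.1, inf_le_left⟩) Set.subset_union_left
  refine ⟨x', y', u, hwx, hxx, hwy, hyy, ⟨?_, fun d hd => ?_⟩, fun z m k hxm hym hk => ?_⟩
  · rintro _ (rfl | rfl)
    · exact hxu
    · rw [le_iff, hy', hu]
      exact Set.insert_subset (Or.inr ⟨hH'.1.1, inf_le_right⟩) Set.subset_union_left
  · have hxd : x' ≤ d := hd (by simp)
    have hyd : y' ≤ d := hd (by simp)
    rw [le_iff, hx', Set.insert_subset_iff] at hxd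
    rw [le_iff, hy', Set.insert_subset_iff] at hyd
    rw [le_iff, hu]
    refine Set.union_subset hxd.2 ?_
    rintro K ⟨hK, hle⟩
    obtain ⟨-, a, b, ha, hb, hab, heq⟩ := hcone hK hle
    obtain ⟨q, hq⟩ := Chamber.nonempty d
    have h1 := (mem_separationSet_iff c₀ hH.1.1 hq).1 hxd.1
    have h2 := (mem_separationSet_iff c₀ hH'.1.1 hq).1 hyd.1
    rw [mem_separationSet_iff c₀ hK hq, heq]
    simp only [LinearMap.add_apply, LinearMap.smul_apply, smul_eq_mul]
    rcases hab with hab | hab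
    · exact add_neg_of_neg_of_nonpos (mul_neg_of_pos_of_neg hab h1)
        (mul_nonpos_of_nonneg_of_nonpos hb h2.le)
    · exact add_neg_of_nonpos_of_neg (mul_nonpos_of_nonneg_of_nonpos ha h1.le)
        (mul_neg_of_pos_of_neg hab h2)
  · have hmx : m ≤ x' := hxm.1 (by simp)
    have hmy : m ≤ y' := hym.1 (by simp)
    have hmz : m ≤ z := hxm.1 (by simp)
    have hku : k ≤ u := hk.1 (by simp)
    have hkz : k ≤ z := hk.1 (by simp)
    have hmk : m ≤ k := hk.2 (by rintro _ (rfl | rfl); exacts [hmx.trans hxu, hmz])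
    by_contra hkm
    -- If `k` exceeds `m`, some upper wall `K` of `m` is crossed on the way to `k`. It must contain
    -- `H ⊓ H'` and differ from `H` and `H'`. But at a point of `K` where the forms of `H` and `H'`
    -- are positive, so is the form of `K`, a contradiction.
    obtain ⟨K, hK, -, v, hv, hmv, hvk⟩ := exists_adjacent_le (lt_of_le_not_ge hmk hkm)
    have hmw : separationSet c₀ m ⊆ separationSet c₀ w := by
      intro J hJ
      have h1 := hmx hJ
      have h2 := hmy hJ
      rw [hx'] at h1
      rw [hy'] at h2
      rcases h1 with rfl | h1
      · rcases h2 with h2 | h2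
        exacts [(hne h2).elim, h2]
      · exact h1
    have hvz := hvk.trans hkz
    have hvx : ¬ v ≤ x' := fun hle =>
      hmv.not_ge (hxm.2 (by rintro _ (rfl | rfl) <;> assumption))
    have hvy : ¬ v ≤ y' := fun hle =>
      hmv.not_ge (hym.2 (by rintro _ (rfl | rfl) <;> assumption))
    rw [le_iff, hv, hx', Set.insert_subset_iff] at hvx
    rw [le_iff, hv, hy', Set.insert_subset_iff] at hvy
    have hKx : K ∉ insert H (separationSet c₀ w) := fun hc =>
      hvx ⟨hc, hmw.trans (Set.subset_insert _ _)⟩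
    have hKy : K ∉ insert H' (separationSet c₀ w) := fun hc =>
      hvy ⟨hc, hmw.trans (Set.subset_insert _ _)⟩
    have hKu : K ∈ separationSet c₀ u := (hvk.trans hku) (hv ▸ Set.mem_insert _ _)
    rw [hu] at hKu
    rcases hKu with hKw | ⟨hKA, hle⟩
    · exact hKx (Or.inr hKw)
    obtain ⟨-, a, b, ha, hb, hab, heq⟩ := hcone hKA hle
    obtain ⟨r, hr, hpos⟩ := exists_point_of_mem_walls hK.1 c₀
    have h1 := hpos H hH.1.1 (fun e => hKx (Or.inl e.symm))
    have h2 := hpos H' hH'.1.1 (fun e => hKy (Or.inl e.symm))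
    rw [orientedForm_of_notMem fun hc => hH.2 (hmw hc)] at h1
    rw [orientedForm_of_notMem fun hc => hH'.2 (hmw hc)] at h2
    have h3 := (baseForm_eq_zero_iff c₀ hKA).2 hr
    rw [heq] at h3
    simp only [LinearMap.add_apply, LinearMap.smul_apply, smul_eq_mul] at h3
    have h4 := mul_nonneg ha h1.le
    have h5 := mul_nonneg hb h2.le
    rcases hab with hab | hab
    · linarith [mul_pos hab h1]
    · linarith [mul_pos hab h2]

theorem covBy_of_separationSet_eq_insert {x y : ChamberPoset c₀}
    {H : Submodule ℝ (EuclideanSpace ℝ (Fin n))} (hH : H ∉ separationSet c₀ x)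
    (h : separationSet c₀ y = insert H (separationSet c₀ x)) : x ⋖ y := by
  have hcov : separationSet c₀ x ⋖ separationSet c₀ y := h ▸ Set.covBy_insert hH
  exact ⟨hcov.lt, fun z hxz hzy => hcov.2 (separationSet_ssubset hxz) (separationSet_ssubset hzy)⟩

end ChamberPoset

/-! ### The implications to and from bineighborliness. -/

open ChamberPoset

theorem IsBineighborly.isSemidistributiveLattice {c₀ : A.Chamber} (h : IsBineighborly c₀) :
    IsSemidistributiveLattice (ChamberPoset c₀) := by
  obtain ⟨ν, hν, hle⟩ := exists_antitone_involution c₀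
  have hloc := exists_local_join h
  have hbot : ∀ x : ChamberPoset c₀, (show ChamberPoset c₀ from c₀) ≤ x := by
    intro x H hH
    obtain ⟨p, hp⟩ := c₀.nonempty
    exact absurd ((mem_separationSet_iff c₀ hH.1 hp).1 hH) (baseForm_pos c₀ hH.1 hp).not_gt
  have hL : IsLatticePoset (ChamberPoset c₀) := by
    refine IsLatticePoset.of_involutive hν hle fun x y =>
      exists_isLUB_pair_of_local (fun w x y hx hy => ?_) _ x y (hbot x) (hbot y)
    obtain ⟨x', y', u, h1, h2, h3, h4, h5, -⟩ := hloc w x y hx hy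
    exact ⟨x', y', u, h1, h2, h3, h4, h5⟩
  exact (isMeetSemidistributiveLattice_of_local hL
    hloc).isSemidistributiveLattice_of_involutive hν hle

/-- If two upper walls of `c` are crossed by `y ≥ c` and no other upper wall of `c` is, then `c` is
incident to their intersection. -/
theorem incident_inf_of_separationSet {c₀ c y : A.Chamber}
    {H H' : Submodule ℝ (EuclideanSpace ℝ (Fin n))} (hH : H ∈ upperWalls c₀ c)
    (hH' : H' ∈ upperWalls c₀ c) (hne : H ≠ H') (hcy : separationSet c₀ c ⊆ separationSet c₀ y)
    (hHy : H ∈ separationSet c₀ y) (hHy' : H' ∈ separationSet c₀ y)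
    (hy : ∀ K ∈ upperWalls c₀ c, K ∈ separationSet c₀ y → K = H ∨ K = H') :
    Incident c (H ⊓ H') := by
  obtain ⟨q, hq⟩ := y.nonempty
  obtain ⟨p₁, hp₁, hpos₁⟩ := exists_point_of_mem_walls hH.1 c₀
  obtain ⟨p₂, hp₂, hpos₂⟩ := exists_point_of_mem_walls hH'.1 c₀
  have h1 := hpos₁ H' hH'.1.1 hne.symm
  have h2 := hpos₂ H hH.1.1 hne
  rw [orientedForm_of_notMem hH'.2] at h1
  rw [orientedForm_of_notMem hH.2] at h2
  have hq1 := (mem_separationSet_iff c₀ hH.1.1 hq).1 hHy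
  have hq2 := (mem_separationSet_iff c₀ hH'.1.1 hq).1 hHy'
  have hz1 := (baseForm_eq_zero_iff c₀ hH.1.1).2 hp₁
  have hz2 := (baseForm_eq_zero_iff c₀ hH'.1.1).2 hp₂
  have hs := div_pos (neg_pos.2 hq2) h1
  have ht := div_pos (neg_pos.2 hq1) h2
  -- Since `p₁` lies in `H` and `p₂` in `H'`, the positive coefficients cancel the negative values
  -- of `q` on `H'` and `H` independently.
  refine (determines_walls c₀ c).incident
    (r := q + (-baseForm c₀ H' q / baseForm c₀ H' p₁) • p₁ +
      (-baseForm c₀ H q / baseForm c₀ H p₂) • p₂) ⟨?_, ?_⟩ fun K hK => ?_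
  · rw [SetLike.mem_coe, ← baseForm_eq_zero_iff c₀ hH.1.1]
    simp [hz1, h2.ne']
  · rw [SetLike.mem_coe, ← baseForm_eq_zero_iff c₀ hH'.1.1]
    simp [hz2, h1.ne']
  by_cases hKH : K = H
  · exact Or.inl (hKH ▸ inf_le_left)
  by_cases hKH' : K = H'
  · exact Or.inl (hKH' ▸ inf_le_right)
  right
  have hqK : 0 < orientedForm c₀ c K q := by
    have hpos := orientedForm_pos (c₀ := c₀) hK.1 hq
    by_cases hs : K ∈ separationSet c₀ c
    · rwa [orientedForm_of_mem hs, ← orientedForm_of_mem (hcy hs)]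
    · have hKy : K ∉ separationSet c₀ y := fun hc =>
        (hy K ⟨hK, hs⟩ hc).elim hKH hKH'
      rwa [orientedForm_of_notMem hs, ← orientedForm_of_notMem hKy]
  simp only [map_add, map_smul, smul_eq_mul]
  have h3 := mul_pos hs (hpos₁ K hK.1 hKH)
  have h4 := mul_pos ht (hpos₂ K hK.1 hKH')
  exact add_pos (add_pos hqK h3) h4

theorem isBineighborly_of_isCrosscutSimplicialLattice {c₀ : A.Chamber}
    (h : IsCrosscutSimplicialLattice (ChamberPoset c₀)) : IsBineighborly c₀ := by
  intro c H hH H' hH'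
  by_cases hne : H = H'
  · rw [← hne, inf_idem]
    exact hH.1.2
  obtain ⟨x, hx⟩ := exists_separationSet_eq_insert hH
  obtain ⟨x', hx'⟩ := exists_separationSet_eq_insert hH'
  change ChamberPoset c₀ at c x x'
  have hcx := covBy_of_separationSet_eq_insert hH.2 hx
  have hcx' := covBy_of_separationSet_eq_insert hH'.2 hx'
  obtain ⟨y, hy⟩ := (h.1 x x').1
  have hxy : x ≤ y := hy.1 (by simp)
  have hxy' : x' ≤ y := hy.1 (by simp)
  have hcy : c ≤ y := hcx.le.trans hxy
  -- As `y` is already the join of `x` and `x'`, these cannot form a proper subset of the atoms. Any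
  -- upper wall of `c` crossed by `y` yields an atom, hence is `H` or `H'`.
  have hatoms : {x, x'} = intervalAtoms c y := by
    by_contra hcon
    refine h.2 c y hcy {x, x'} (lt_of_le_of_ne ?_ hcon) hy
    rintro _ (rfl | rfl)
    exacts [⟨hcx, hxy⟩, ⟨hcx', hxy'⟩]
  refine incident_inf_of_separationSet (y := y) hH hH' hne hcy (hxy (hx ▸ Set.mem_insert _ _))
    (hxy' (hx' ▸ Set.mem_insert _ _)) fun K hK hKy => ?_
  obtain ⟨v, hv⟩ := exists_separationSet_eq_insert hK
  change ChamberPoset c₀ at v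
  have hvy : v ≤ y := by
    rw [le_iff, hv]
    exact Set.insert_subset hKy hcy
  have hmem : v ∈ ({x, x'} : Set (ChamberPoset c₀)) :=
    hatoms ▸ ⟨covBy_of_separationSet_eq_insert hK.2 hv, hvy⟩
  have hKv : K ∈ separationSet c₀ v := hv ▸ Set.mem_insert _ _
  rcases hmem with rfl | rfl
  · rw [hx] at hKv
    exact Or.inl (hKv.resolve_right hK.2)
  · rw [hx'] at hKv
    exact Or.inr (hKv.resolve_right hK.2)

end CentralArrangement

theorem theorem3p3 {n : ℕ} (A : CentralArrangement n) (c₀ : A.Chamber) :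
    List.TFAE
      [IsCrosscutSimplicialLattice (CentralArrangement.ChamberPoset c₀),
       IsSemidistributiveLattice (CentralArrangement.ChamberPoset c₀),
       CentralArrangement.IsBineighborly c₀] := by
  tfae_have 1 → 3 := CentralArrangement.isBineighborly_of_isCrosscutSimplicialLattice
  tfae_have 3 → 2 := CentralArrangement.IsBineighborly.isSemidistributiveLattice
  tfae_have 2 → 1 := fun h => h.1.isCrosscutSimplicialLattice
  tfae_finish
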